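/- Let $K$ be a field with a nontrivial valuation $v$, with totally ordered abelian value group $\Lambda=v(K^\times)$ (written additively, $v(0)=\infty$), valuation ring $\mathcal{O}=\{x\in K: v(x)\ge 0\}\neq K$, maximal ideal $\mathfrak{m}=\{x\in K: v(x)>0\}$, residue field $k=\mathcal{O}/\mathfrak{m}$ and unit group $\mathcal{O}^\times=\{x\in K: v(x)=0\}$. For every $\alpha\in\Lambda$ with $\alpha>0$ fix $t_\alpha\in\mathcal{O}$ with $v(t_\alpha)=\alpha$, and put $u_{\alpha,\beta}=t_\alpha t_\beta/t_{\alpha+\beta}\in\mathcal{O}^\times$ for $\alpha,\beta>0$. Let $\mathfrak{k}\subseteq\mathcal{O}^\times\setminus(1+\mathfrak{m})$ be a set of representatives modulo $\mathfrak{m}$ of the elements of $k^\times\setminus\{1\}$. Write $[x,y]=xyx^{-1}y^{-1}$ and $x^y=y^{-1}xy$. Then the group $GL_2(K)$ is generated by the matrices $$R(a)=\begin{pmatrix}a&0\\0&1\end{pmatrix}\ (a\in\mathcal{O}^\times\setminus\{1\}),\quad S=\begin{pmatrix}-1&1\\0&1\end{pmatrix},\quad J=\begin{pmatrix}0&-1\\-1&0\end{pmatrix},\quad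 T_\alpha=\begin{pmatrix}0&-1\\-t_\alpha&0\end{pmatrix}\ (0<\alpha\in\Lambda),$$ and the following relations are defining relations for these generators. Here $R(1)=Z(1)=1$, and the following abbreviations are used: $Z(a)=(JR(a))^2$ for $a\in\mathcal{O}^\times\setminus\{1\}$; $Z(t_\alpha)=T_\alpha^2$, $S_\alpha=[S,R(1-t_\alpha)]\,R(-1)$ and $J_\alpha=JS_\alpha J$ for $\alpha>0$. The indices $a,b$ range over $\mathcal{O}^\times\setminus\{1\}$ and $\alpha,\beta,\gamma$ over the positive elements of $\Lambda$, except where stated otherwise. 1. $R(a)R(b)=R(ab)$, $\;Z(a)Z(b)=Z(ab)$, $\;[R(a),Z(b)]=1$; 2. $[S,Z(a)]=1$, $\;S^2=1$; 3. $[S,R(1-at_\alpha)]=R(a)\,[S,R(1-t_\alpha)]\,R(a)^{-1}$; 4. $S\,R(a)\,S=R(1-a)\,S\,R\!\left(\tfrac{a}{a-1}\right)$ for $a\in\mathfrak{k}$; 5. $J^2=(JS)^3=1$; 6. $[T_\alpha,Z(a)]=1$, $\;[T_\alpha,Z(t_\gamma)]=1$; 7. $R(a)^{T_\alpha}=R(a)^{-1}Z(a)$,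 $\;S^{T_\alpha}=J_\alpha$, $\;J_\alpha^{T_\alpha}=S$; 8. $T_\alpha\,J\,T_\beta=T_{\alpha+\beta}\,R(u_{\alpha,\beta})$. That is, the group abstractly presented by these generators and relations is isomorphic to $GL_2(K)$ via the map sending each generator to the matrix of the same name. Under this isomorphism $Z(a)$, $Z(t_\alpha)$ and $J_\alpha$ correspond to the matrices $\begin{pmatrix}a&0\\0&a\end{pmatrix}$, $\begin{pmatrix}t_\alpha&0\\0&t_\alpha\end{pmatrix}$ and $\begin{pmatrix}1&0\\t_\alpha&-1\end{pmatrix}$, respectively. -/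

import Mathlib

namespace ValuedGL2

open scoped commutatorElement

section UnitFacts

variable {K Λ : Type*} [Field K] [AddCommGroup Λ] [LinearOrder Λ] [IsOrderedAddMonoid Λ]
  {v : AddValuation K (WithTop Λ)}

theorem val_neg_one : v (-1) = 0 := by
  rw [v.map_neg, v.map_one]

theorem val_mul {a b : K} (ha : v a = 0) (hb : v b = 0) : v (a * b) = 0 := by
  rw [v.map_mul, ha, hb, add_zero]

theorem val_one_sub {x : K} (hx : 0 < v x) : v (1 - x) = 0 := by
  have h := v.map_sub_eq_of_lt_left (x := 1) (y := x) (by rwa [v.map_one])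
  rwa [v.map_one] at h

theorem val_unit_mul {a x : K} (ha : v a = 0) (hx : 0 < v x) : 0 < v (a * x) := by
  rwa [v.map_mul, ha, zero_add]

theorem val_div_sub_one {a : K} (ha : v a = 0) (ha' : v (1 - a) = 0) : v (a / (a - 1)) = 0 := by
  rw [v.map_div, v.map_sub_swap, ha, ha', sub_zero]

variable {t : {α : Λ // 0 < α} → K}

theorem val_t_pos (ht : ∀ α, v (t α) = ((α : Λ) : WithTop Λ)) (α : {α : Λ // 0 < α}) :
    0 < v (t α) := by
  rw [ht]
  exact_mod_cast α.2

theorem val_u (ht : ∀ α, v (t α) = ((α : Λ) : WithTop Λ)) (α β : {α : Λ // 0 < α}) :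
    v (t α * t β / t (α + β)) = 0 := by
  rw [v.map_div, v.map_mul, ht, ht, ht, Positive.coe_add, WithTop.coe_add,
    ← WithTop.coe_add, ← WithTop.LinearOrderedAddCommGroup.coe_sub, sub_self, WithTop.coe_zero]

end UnitFacts

variable {K Λ : Type*} [Field K] [AddCommGroup Λ] [LinearOrder Λ] [IsOrderedAddMonoid Λ]

/-- The generating symbols: `R a` for the units `a ≠ 1` of the valuation ring
(the elements of value `0`), `S`, `J`, and `T α` for the positive elements `α` of the value
group. -/
inductive Gen (v : AddValuation K (WithTop Λ))
  | R (a : K) (ha : v a = 0) (ha1 : a ≠ 1)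
  | S
  | J
  | T (α : {α : Λ // 0 < α})

/-- The matrix named by a generating symbol. -/
def Gen.toMatrix {v : AddValuation K (WithTop Λ)} (t : {α : Λ // 0 < α} → K) :
    Gen v → Matrix (Fin 2) (Fin 2) K
  | .R a _ _ => !![a, 0; 0, 1]
  | .S => !![-1, 1; 0, 1]
  | .J => !![0, -1; -1, 0]
  | .T α => !![0, -1; -(t α), 0]

section Words

variable {v : AddValuation K (WithTop Λ)}

open Classical in
/-- The word `R(a)`, for a unit `a` of the valuation ring, with the convention `R(1) = 1`. -/
noncomputable def R (a : K) (ha : v a = 0) : FreeGroup (Gen v) :=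
  if ha1 : a = 1 then 1 else FreeGroup.of (Gen.R a ha ha1)

def S (v : AddValuation K (WithTop Λ)) : FreeGroup (Gen v) := FreeGroup.of Gen.S

def J (v : AddValuation K (WithTop Λ)) : FreeGroup (Gen v) := FreeGroup.of Gen.J

def T (v : AddValuation K (WithTop Λ)) (α : {α : Λ // 0 < α}) : FreeGroup (Gen v) :=
  FreeGroup.of (Gen.T α)

open Classical in
/-- The word `Z(a) = (J R(a))²`, for a unit `a` of the valuation ring, with the convention
`Z(1) = 1`. -/
noncomputable def Z (a : K) (ha : v a = 0) : FreeGroup (Gen v) :=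
  if a = 1 then 1 else (J v * R a ha) ^ 2

/-- The word `Z(t_α) = T_α²`. -/
def Zt (α : {α : Λ // 0 < α}) : FreeGroup (Gen v) := T v α ^ 2

variable {t : {α : Λ // 0 < α} → K}

/-- The word `S_α = [S, R(1 - t_α)] R(-1)`, where `[x, y] = x y x⁻¹ y⁻¹`. -/
noncomputable def Sα (ht : ∀ α, v (t α) = ((α : Λ) : WithTop Λ)) (α : {α : Λ // 0 < α}) :
    FreeGroup (Gen v) :=
  ⁅S v, R (1 - t α) (val_one_sub (val_t_pos ht α))⁆ * R (-1) val_neg_one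

/-- The word `J_α = J S_α J`. -/
noncomputable def Jα (ht : ∀ α, v (t α) = ((α : Λ) : WithTop Λ)) (α : {α : Λ // 0 < α}) :
    FreeGroup (Gen v) :=
  J v * Sα ht α * J v

end Words

/-- `𝔨` is a set of units of the valuation ring that represents each element other than `0` and
`1` of the residue field exactly once, and represents neither `0` nor `1`. -/
def IsResidueSystem (v : AddValuation K (WithTop Λ)) (𝔨 : Set K) : Prop :=
  (∀ a ∈ 𝔨, v a = 0 ∧ v (1 - a) = 0) ∧
    ∀ b : K, v b = 0 → v (1 - b) = 0 → ∃! a, a ∈ 𝔨 ∧ 0 < v (b - a)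

/-- The defining relations: `Relation ht h𝔨 x y` means that `x = y` is one of them. -/
inductive Relation {v : AddValuation K (WithTop Λ)} {t : {α : Λ // 0 < α} → K}
    (ht : ∀ α, v (t α) = ((α : Λ) : WithTop Λ)) {𝔨 : Set K} (h𝔨 : IsResidueSystem v 𝔨) :
    FreeGroup (Gen v) → FreeGroup (Gen v) → Prop
  | R_mul (a b : K) (ha : v a = 0) (hb : v b = 0) (ha1 : a ≠ 1) (hb1 : b ≠ 1) :
      Relation ht h𝔨 (R a ha * R b hb) (R (a * b) (val_mul ha hb))
  | Z_mul (a b : K) (ha : v a = 0) (hb : v b = 0) (ha1 : a ≠ 1) (hb1 : b ≠ 1) :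
      Relation ht h𝔨 (Z a ha * Z b hb) (Z (a * b) (val_mul ha hb))
  | R_comm_Z (a b : K) (ha : v a = 0) (hb : v b = 0) (ha1 : a ≠ 1) (hb1 : b ≠ 1) :
      Relation ht h𝔨 ⁅R a ha, Z b hb⁆ 1
  | S_comm_Z (a : K) (ha : v a = 0) (ha1 : a ≠ 1) :
      Relation ht h𝔨 ⁅S v, Z a ha⁆ 1
  | S_sq : Relation ht h𝔨 (S v ^ 2) 1
  | S_comm_R (α : {α : Λ // 0 < α}) (a : K) (ha : v a = 0) (ha1 : a ≠ 1) :
      Relation ht h𝔨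
        ⁅S v, R (1 - a * t α) (val_one_sub (val_unit_mul ha (val_t_pos ht α)))⁆
        (R a ha * ⁅S v, R (1 - t α) (val_one_sub (val_t_pos ht α))⁆ * (R a ha)⁻¹)
  | S_R_S (a : K) (ha : a ∈ 𝔨) :
      Relation ht h𝔨
        (S v * R a (h𝔨.1 a ha).1 * S v)
        (R (1 - a) (h𝔨.1 a ha).2 * S v *
          R (a / (a - 1)) (val_div_sub_one (h𝔨.1 a ha).1 (h𝔨.1 a ha).2))
  | J_sq : Relation ht h𝔨 (J v ^ 2) 1
  | JS_cube : Relation ht h𝔨 ((J v * S v) ^ 3) 1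
  | T_comm_Z (α : {α : Λ // 0 < α}) (a : K) (ha : v a = 0) (ha1 : a ≠ 1) :
      Relation ht h𝔨 ⁅T v α, Z a ha⁆ 1
  | T_comm_Zt (α γ : {α : Λ // 0 < α}) :
      Relation ht h𝔨 ⁅T v α, Zt γ⁆ 1
  | R_conj_T (α : {α : Λ // 0 < α}) (a : K) (ha : v a = 0) (ha1 : a ≠ 1) :
      Relation ht h𝔨 ((T v α)⁻¹ * R a ha * T v α) ((R a ha)⁻¹ * Z a ha)
  | S_conj_T (α : {α : Λ // 0 < α}) :
      Relation ht h𝔨 ((T v α)⁻¹ * S v * T v α) (Jα ht α)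
  | Jα_conj_T (α : {α : Λ // 0 < α}) :
      Relation ht h𝔨 ((T v α)⁻¹ * Jα ht α * T v α) (S v)
  | T_J_T (α β : {α : Λ // 0 < α}) :
      Relation ht h𝔨 (T v α * J v * T v β)
        (T v (α + β) * R (t α * t β / t (α + β)) (val_u ht α β))

/-- The set of relators `x y⁻¹` belonging to the defining relations `x = y`. -/
def relators {v : AddValuation K (WithTop Λ)} {t : {α : Λ // 0 < α} → K}
    (ht : ∀ α, v (t α) = ((α : Λ) : WithTop Λ)) {𝔨 : Set K} (h𝔨 : IsResidueSystem v 𝔨) :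
    Set (FreeGroup (Gen v)) :=
  {w | ∃ x y, Relation ht h𝔨 x y ∧ w = x * y⁻¹}

end ValuedGL2

/-! The matrices satisfy the relations by direct computation, so the point is that the relations
suffice. Let `G` be a group in which they hold. Since `J T_α` is the matrix `diag(t_α, 1)`, it plays
the role of `R(t_α)`. Relations 7 and 8 make the `R(a)` and `J T_α` multiplicative on elements of
positive value, and these generate `Kˣ`; this yields a torus homomorphism `r : Kˣ → G`
(`exists_torus`). Conjugating `S R(-1)`, the matrix `(1 1; 0 1)`, by `r x` gives root elements `u
x`.

The crux is that `u` is additive (`rootMap_add`). By scaling this means `u 1 * u (-a) = u (1 - a)`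
for all `a`. The set of such `a` is stable under `a ↦ a⁻¹` and `a ↦ 1 - a`, so it is enough to have
it on `1 + 𝔪` (relations 3 and 7) and on the residue representatives (relation 4).

The elements `(J r x)²` are central (`commute_jr_sq`), and `(JS)³ = 1` puts `J u(x) J` with `x ≠ 0`
in the big cell. Hence `G` is the union of two Bruhat cells (`mem_cells_of_closure`). For the
presented group, the normal form in these cells can be read off the matrix, which gives injectivity;
every invertible matrix has such a form, which gives surjectivity. -/

namespace ValuedGL2

open scoped commutatorElement

/-! ### Extending homomorphisms from a cofinal subsemigroup -/

section Extension

variable {A G : Type*} [CommGroup A] [Group G]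

/-- A map that is multiplicative on a cofinal subsemigroup `P` of a commutative group extends
from `P` to a homomorphism on the whole group. -/
theorem exists_monoidHom_eq_on (P : A → Prop) (hP : ∀ x y, P x → P y → P (x * y))
    (hcof : ∀ x, ∃ y, P y ∧ P (x * y)) (f : A → G)
    (hf : ∀ x y, P x → P y → f (x * y) = f x * f y) :
    ∃ r : A →* G, ∀ x, P x → r x = f x := by
  have hcomm : ∀ x y, P x → P y → Commute (f x) (f y) := fun x y hx hy => by
    rw [Commute, SemiconjBy, ← hf x y hx hy, ← hf y x hy hx, mul_comm]
  choose y hy hxy using hcof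
  -- The quotient `f (x * z) * (f z)⁻¹` does not depend on `z`, because the values of `f` on `P`
  -- commute.
  have key : ∀ x z, P z → P (x * z) → f (x * y x) * (f (y x))⁻¹ = f (x * z) * (f z)⁻¹ := by
    intro x z hz hxz
    have e : f (x * y x) * f z = f (x * z) * f (y x) := by
      rw [← hf _ _ (hxy x) hz, ← hf _ _ hxz (hy x), mul_right_comm]
    rw [mul_inv_eq_iff_eq_mul, mul_assoc, ((hcomm _ _ (hy x) hz).inv_right).eq.symm, ← mul_assoc,
      ← e, mul_inv_cancel_right]
  refine ⟨MonoidHom.mk' (fun x => f (x * y x) * (f (y x))⁻¹) fun a b => ?_, fun x hx => ?_⟩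
  · have e : a * b * (y a * y b) = (a * y a) * (b * y b) := mul_mul_mul_comm _ _ _ _
    rw [key (a * b) (y a * y b) (hP _ _ (hy a) (hy b)) (e ▸ hP _ _ (hxy a) (hxy b)), e,
      hf _ _ (hxy a) (hxy b), hf _ _ (hy a) (hy b), mul_inv_rev, mul_assoc, mul_assoc,
      ← mul_assoc (f (b * y b)), ((hcomm _ _ (hxy b) (hy a)).inv_right.mul_left
        (hcomm _ _ (hy b) (hy a)).inv_left.inv_right).eq]
  · change f (x * y x) * (f (y x))⁻¹ = f x
    rw [hf _ _ hx (hy x), mul_inv_cancel_right]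

end Extension

/-! ### Root elements and their additivity -/

section Unipotent

variable {K G : Type*} [Field K] [Group G]

open Classical in
/-- The conjugates `r x * g * (r x)⁻¹`, extended by the value `1` at `x = 0`. -/
noncomputable def rootMap (r : Kˣ →* G) (g : G) (x : K) : G :=
  if h : x = 0 then 1 else r (Units.mk0 x h) * g * (r (Units.mk0 x h))⁻¹

variable (r : Kˣ →* G) (g : G)

@[simp] theorem rootMap_zero : rootMap r g 0 = 1 := by simp [rootMap]

theorem rootMap_unit (c : Kˣ) : rootMap r g c = r c * g * (r c)⁻¹ := by
  simp [rootMap]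

@[simp] theorem rootMap_one : rootMap r g 1 = g := by
  simpa using rootMap_unit r g 1

theorem conj_rootMap (c : Kˣ) (x : K) :
    r c * rootMap r g x * (r c)⁻¹ = rootMap r g (c * x) := by
  by_cases h : x = 0
  · simp [h]
  · lift x to Kˣ using isUnit_iff_ne_zero.mpr h
    rw [← Units.val_mul, rootMap_unit, rootMap_unit, map_mul]
    group

theorem mul_rootMap (c : Kˣ) (x : K) : r c * rootMap r g x = rootMap r g (c * x) * r c := by
  rw [← conj_rootMap, inv_mul_cancel_right]

theorem rootMap_mul (c : Kˣ) (x : K) :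
    rootMap r g x * r c = r c * rootMap r g ((c⁻¹ : Kˣ) * x) := by
  rw [mul_rootMap, ← mul_assoc, Units.mul_inv, one_mul]

variable {r g}

/-- Conjugation by `r x` multiplies all arguments by `x`, so additivity need only be tested with
first argument `1`. -/
theorem rootMap_add_of_div {a x : K} (hx : x ≠ 0)
    (h : rootMap r g 1 * rootMap r g (-a) = rootMap r g (1 - a)) :
    rootMap r g x * rootMap r g (-(x * a)) = rootMap r g (x - x * a) := by
  have := congrArg (fun z => r (Units.mk0 x hx) * z * (r (Units.mk0 x hx))⁻¹) h
  simp only [conj_rootMap, conj_mul.symm, Units.val_mk0] at this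
  convert this using 3 <;> ring

theorem rootMap_neg (h1 : rootMap r g 1 * rootMap r g (-1) = 1) (x : K) :
    rootMap r g (-x) = (rootMap r g x)⁻¹ := by
  by_cases hx : x = 0
  · simp [hx]
  · have := rootMap_add_of_div (r := r) (g := g) (a := 1) hx (by simpa using h1)
    rw [eq_comm, inv_eq_iff_mul_eq_one]
    simpa using this

/-- Scale the identity for `a` by `a⁻¹` and invert both sides. -/
theorem rootMap_one_sub_inv (h1 : rootMap r g 1 * rootMap r g (-1) = 1) {a : K} (ha : a ≠ 0)
    (h : rootMap r g 1 * rootMap r g (-a) = rootMap r g (1 - a)) :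
    rootMap r g 1 * rootMap r g (-a⁻¹) = rootMap r g (1 - a⁻¹) := by
  have := rootMap_add_of_div (x := a⁻¹) (inv_ne_zero ha) h
  rw [inv_mul_cancel₀ ha] at this
  have h2 := congrArg (·⁻¹) this
  simp only [mul_inv_rev, ← rootMap_neg h1, neg_neg] at h2
  rw [h2]
  congr 1
  ring

/-- Scaling the identity for `a⁻¹` by `-a` gives `u (-a) * u 1 = u (1 - a)`; solve for `u a`. -/
theorem rootMap_one_sub_one_sub (h1 : rootMap r g 1 * rootMap r g (-1) = 1) {a : K}
    (h : rootMap r g 1 * rootMap r g (-a) = rootMap r g (1 - a)) :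
    rootMap r g 1 * rootMap r g (-(1 - a)) = rootMap r g (1 - (1 - a)) := by
  by_cases ha : a = 0
  · simpa [ha] using h1
  · have := rootMap_add_of_div (x := -a) (neg_ne_zero.mpr ha) (rootMap_one_sub_inv h1 ha h)
    rw [neg_mul, mul_inv_cancel₀ ha, neg_neg, sub_neg_eq_add, neg_add_eq_sub] at this
    rw [rootMap_neg h1, ← this, rootMap_neg h1]
    simp

variable {Λ : Type*} [AddCommGroup Λ] [LinearOrder Λ] [IsOrderedAddMonoid Λ]

/-- If `U 1 * U (-a) = U (1 - a)` for `a` in the residue system and in `1 + 𝔪`, then `U` is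
additive. -/
theorem rootMap_add (v : AddValuation K (WithTop Λ)) {𝔨 : Set K} (h𝔨 : IsResidueSystem v 𝔨)
    (hres : ∀ a ∈ 𝔨, rootMap r g 1 * rootMap r g (-a) = rootMap r g (1 - a))
    (hone : ∀ a, 0 < v (1 - a) → rootMap r g 1 * rootMap r g (-a) = rootMap r g (1 - a))
    (x y : K) : rootMap r g (x + y) = rootMap r g x * rootMap r g y := by
  have h1 : rootMap r g 1 * rootMap r g (-1) = 1 := by
    simpa using hone 1 (by simp)
  have hpos : ∀ a, 0 < v a → rootMap r g 1 * rootMap r g (-a) = rootMap r g (1 - a) := by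
    intro a ha
    simpa using rootMap_one_sub_one_sub h1 (hone (1 - a) (by simpa using ha))
  have hsub : ∀ x y, v x < v y → rootMap r g x * rootMap r g (-y) = rootMap r g (x - y) := by
    intro x y hxy
    have hx : x ≠ 0 := by
      rintro rfl
      simp at hxy
    have := rootMap_add_of_div hx (hpos (y / x) ?_)
    · rwa [mul_div_cancel₀ _ hx] at this
    · by_contra hle
      rw [not_lt] at hle
      have := add_le_add_left hle (v x)
      rw [← v.map_mul, div_mul_cancel₀ _ hx, zero_add] at this
      exact this.not_gt hxy
  have hall : ∀ a, rootMap r g 1 * rootMap r g (-a) = rootMap r g (1 - a) := by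
    intro a
    rcases lt_trichotomy (v a) 0 with ha | ha | ha
    · have ha0 : a ≠ 0 := by
        rintro rfl
        simp at ha
      have := rootMap_one_sub_inv h1 (inv_ne_zero ha0) (hpos a⁻¹ ?_)
      · simpa using this
      · by_contra hle
        have h := v.map_mul a⁻¹ a
        rw [inv_mul_cancel₀ ha0, v.map_one] at h
        exact absurd (h.trans_le ((add_le_of_nonpos_left (not_lt.mp hle)))) ha.not_ge
    · by_cases h : 0 < v (1 - a)
      · exact hone a h
      · have h0 : v (1 - a) = 0 := le_antisymm (not_lt.mp h) (by
          have := v.map_sub 1 a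
          rwa [v.map_one, ha, min_self] at this)
        -- Both `-b` and `1 - b` have value `0`, so each dominates the error `a - b`. Subtracting
        -- the error from both sides of the identity for `b` gives the one for `a`.
        obtain ⟨b, ⟨hb, hab⟩, -⟩ := h𝔨.2 a ha h0
        obtain ⟨hb0, hb1⟩ := h𝔨.1 b hb
        have e1 := hsub (-b) (a - b) (by rwa [v.map_neg, hb0])
        have e2 := hsub (1 - b) (a - b) (by rwa [hb1])
        rw [show -b - (a - b) = -a by ring] at e1
        rw [show 1 - b - (a - b) = 1 - a by ring] at e2
        rw [← e1, ← mul_assoc, hres b hb, e2]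
    · exact hpos a ha
  by_cases hx : x = 0
  · simp [hx]
  · have := rootMap_add_of_div hx (hall (-(y / x)))
    rw [mul_neg, mul_div_cancel₀ _ hx, neg_neg, sub_neg_eq_add] at this
    exact this.symm

end Unipotent

/-! ### The torus inside a group satisfying the relations -/

section Torus

variable {K Λ : Type*} [Field K] [AddCommGroup Λ] [LinearOrder Λ] [IsOrderedAddMonoid Λ]
  {v : AddValuation K (WithTop Λ)}

theorem ne_zero_of_val {a : K} (ha : v a = 0) : a ≠ 0 := by
  rintro rfl
  simp at ha

theorem R_one (h : v (1 : K) = 0) : R 1 h = 1 := by simp [R]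

theorem Z_one (h : v (1 : K) = 0) : Z 1 h = 1 := by simp [Z]

theorem R_congr {a b : K} (h : a = b) (ha : v a = 0) : R a ha = R b (h ▸ ha) := by
  subst h
  rfl

variable {t : {α : Λ // 0 < α} → K} {ht : ∀ α, v (t α) = ((α : Λ) : WithTop Λ)} {𝔨 : Set K}
  {h𝔨 : IsResidueSystem v 𝔨} {G : Type*} [Group G] {π : FreeGroup (Gen v) →* G}

theorem map_J_mul_map_J (hπ : ∀ x y, Relation ht h𝔨 x y → π x = π y) :
    π (J v) * π (J v) = 1 := by
  simpa [sq] using hπ _ _ .J_sq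

theorem map_J_inv (hπ : ∀ x y, Relation ht h𝔨 x y → π x = π y) :
    (π (J v))⁻¹ = π (J v) :=
  inv_eq_of_mul_eq_one_left (map_J_mul_map_J hπ)

theorem map_S_mul_map_S (hπ : ∀ x y, Relation ht h𝔨 x y → π x = π y) :
    π (S v) * π (S v) = 1 := by
  simpa [sq] using hπ _ _ .S_sq

theorem map_S_inv (hπ : ∀ x y, Relation ht h𝔨 x y → π x = π y) :
    (π (S v))⁻¹ = π (S v) :=
  inv_eq_of_mul_eq_one_left (map_S_mul_map_S hπ)

theorem map_R_mul (hπ : ∀ x y, Relation ht h𝔨 x y → π x = π y) {a b : K} (ha : v a = 0)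
    (hb : v b = 0) : π (R a ha) * π (R b hb) = π (R (a * b) (val_mul ha hb)) := by
  by_cases ha1 : a = 1
  · subst ha1
    rw [R_one, R_congr (one_mul b), map_one, one_mul]
  by_cases hb1 : b = 1
  · subst hb1
    rw [R_one, R_congr (mul_one a), map_one, mul_one]
  rw [← map_mul, hπ _ _ (.R_mul a b ha hb ha1 hb1)]

theorem commute_map_R_Z (hπ : ∀ x y, Relation ht h𝔨 x y → π x = π y) {a b : K} (ha : v a = 0)
    (hb : v b = 0) : Commute (π (R a ha)) (π (Z b hb)) := by
  by_cases ha1 : a = 1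
  · subst ha1
    simp [R_one]
  by_cases hb1 : b = 1
  · subst hb1
    simp [Z_one]
  simpa [commutatorElement_eq_one_iff_commute] using hπ _ _ (.R_comm_Z a b ha hb ha1 hb1)

theorem commute_map_S_Z (hπ : ∀ x y, Relation ht h𝔨 x y → π x = π y) {b : K} (hb : v b = 0) :
    Commute (π (S v)) (π (Z b hb)) := by
  by_cases hb1 : b = 1
  · subst hb1
    simp [Z_one]
  simpa [commutatorElement_eq_one_iff_commute] using hπ _ _ (.S_comm_Z b hb hb1)

theorem commute_map_T_Z (hπ : ∀ x y, Relation ht h𝔨 x y → π x = π y) (α : {α : Λ // 0 < α})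
    {b : K} (hb : v b = 0) : Commute (π (T v α)) (π (Z b hb)) := by
  by_cases hb1 : b = 1
  · subst hb1
    simp [Z_one]
  simpa [commutatorElement_eq_one_iff_commute] using hπ _ _ (.T_comm_Z α b hb hb1)

theorem map_Z (hπ : ∀ x y, Relation ht h𝔨 x y → π x = π y) {a : K} (ha : v a = 0) :
    π (Z a ha) = (π (J v) * π (R a ha)) ^ 2 := by
  by_cases ha1 : a = 1
  · subst ha1
    rw [R_one, Z_one, map_one, mul_one, sq, map_J_mul_map_J hπ]
  rw [Z, if_neg ha1, map_pow, map_mul]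

theorem J_conj_R (hπ : ∀ x y, Relation ht h𝔨 x y → π x = π y) {a : K} (ha : v a = 0) :
    π (J v) * π (R a ha) * π (J v) = (π (R a ha))⁻¹ * π (Z a ha) := by
  rw [(commute_map_R_Z hπ ha ha).inv_left.eq, map_Z hπ, eq_mul_inv_iff_mul_eq, sq]
  simp only [mul_assoc]

theorem commute_map_J_Z (hπ : ∀ x y, Relation ht h𝔨 x y → π x = π y) {a : K} (ha : v a = 0) :
    Commute (π (J v)) (π (Z a ha)) := by
  symm
  calc π (Z a ha) * π (J v)
      = π (J v) * π (R a ha) * (π (J v) * π (R a ha) * π (J v)) := by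
        rw [map_Z hπ, sq]
        simp only [mul_assoc]
    _ = π (J v) * π (Z a ha) := by rw [J_conj_R hπ, mul_assoc, mul_inv_cancel_left]

theorem R_conj_T (hπ : ∀ x y, Relation ht h𝔨 x y → π x = π y) (α : {α : Λ // 0 < α}) {a : K}
    (ha : v a = 0) :
    (π (T v α))⁻¹ * π (R a ha) * π (T v α) = (π (R a ha))⁻¹ * π (Z a ha) := by
  by_cases ha1 : a = 1
  · subst ha1
    simp [R_one, Z_one]
  simpa using hπ _ _ (.R_conj_T α a ha ha1)

/-- `J` and `T_α` both conjugate `R(a)` to `R(a)⁻¹ Z(a)`, so their product centralizes `R(a)`. -/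
theorem commute_map_JT_R (hπ : ∀ x y, Relation ht h𝔨 x y → π x = π y) (α : {α : Λ // 0 < α})
    {a : K} (ha : v a = 0) : Commute (π (J v) * π (T v α)) (π (R a ha)) := by
  have h1 := R_conj_T hπ α ha
  have h2 : π (R a ha) * π (J v) = π (J v) * ((π (R a ha))⁻¹ * π (Z a ha)) := by
    rw [← J_conj_R hπ ha, ← mul_assoc, ← mul_assoc, map_J_mul_map_J hπ, one_mul]
  have h3 : (π (T v α))⁻¹ * (π (R a ha))⁻¹ * π (T v α) = (π (Z a ha))⁻¹ * π (R a ha) := by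
    rw [← inv_inj]
    simpa [mul_assoc] using h1
  symm
  calc π (R a ha) * (π (J v) * π (T v α))
      = π (J v) * π (T v α) * ((π (T v α))⁻¹ * (π (R a ha))⁻¹ * π (T v α)) *
          ((π (T v α))⁻¹ * (π (Z a ha) * π (T v α))) := by
        rw [← mul_assoc, h2]
        group
    _ = π (J v) * π (T v α) * π (R a ha) := by
        rw [h3, ← (commute_map_T_Z hπ α ha).eq, inv_mul_cancel_left, mul_assoc _ _ (π (Z a ha)),
          mul_assoc _ _ (π (Z a ha)), (commute_map_R_Z hπ ha ha).eq, inv_mul_cancel_left]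

/-- Relation 8 multiplied by `J`: it says `R(t_α) R(t_β) = R(t_{α+β}) R(u_{α,β})`. -/
theorem map_JT_mul_map_JT (hπ : ∀ x y, Relation ht h𝔨 x y → π x = π y)
    (α β : {α : Λ // 0 < α}) :
    (π (J v) * π (T v α)) * (π (J v) * π (T v β)) =
      π (J v) * π (T v (α + β)) * π (R (t α * t β / t (α + β)) (val_u ht α β)) := by
  have := hπ _ _ (.T_J_T α β)
  simp only [map_mul] at this
  rw [mul_assoc, mul_assoc, ← this]
  group

theorem exists_unit_mul_t (ht : ∀ α, v (t α) = ((α : Λ) : WithTop Λ)) {x : K} (hx : x ≠ 0)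
    (hpos : 0 < v x) : ∃ (α : {α : Λ // 0 < α}) (a : K), v a = 0 ∧ x = a * t α := by
  obtain ⟨α, hα⟩ := WithTop.ne_top_iff_exists.mp ((v.ne_top_iff).mpr hx)
  rw [← hα] at hpos
  let α' : {α : Λ // 0 < α} := ⟨α, by exact_mod_cast hpos⟩
  have ht0 : t α' ≠ 0 := by
    intro h
    have := ht α'
    simp [h] at this
  refine ⟨α', x / t α', ?_, (div_mul_cancel₀ _ ht0).symm⟩
  rw [v.map_div, ht, ← hα, ← WithTop.LinearOrderedAddCommGroup.coe_sub, sub_self, WithTop.coe_zero]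

theorem t_ne_zero (ht : ∀ α, v (t α) = ((α : Λ) : WithTop Λ)) (α : {α : Λ // 0 < α}) :
    t α ≠ 0 := by
  intro h
  have := ht α
  simp [h] at this

/-- The images of `R a` and of `J T_α`, which stands for `R(t_α)`, extend to a homomorphism on
`Kˣ`. -/
theorem exists_torus (hπ : ∀ x y, Relation ht h𝔨 x y → π x = π y) (hα : Nonempty {α : Λ // 0 < α}) :
    ∃ r : Kˣ →* G,
      (∀ (a : K) (ha : v a = 0), r (Units.mk0 a (ne_zero_of_val ha)) = π (R a ha)) ∧
      ∀ α, r (Units.mk0 (t α) (t_ne_zero ht α)) = π (J v) * π (T v α) := by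
  choose! deg un hun using fun (x : Kˣ) (hx : 0 < v (x : K)) => exists_unit_mul_t ht x.ne_zero hx
  classical
  let f : Kˣ → G := fun x =>
    if h : 0 < v (x : K) then π (R (un x) (hun x h).1) * (π (J v) * π (T v (deg x))) else 1
  have hf : ∀ (x : Kˣ) (α : {α : Λ // 0 < α}) (a : K) (ha : v a = 0), (x : K) = a * t α →
      f x = π (R a ha) * (π (J v) * π (T v α)) := by
    intro x α a ha hx
    have hpos : 0 < v (x : K) := by
      rw [hx]
      exact val_unit_mul ha (val_t_pos ht α)
    obtain ⟨h0, h1⟩ := hun x hpos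
    have hdeg : deg x = α := by
      have := congrArg v (hx.symm.trans h1)
      rw [v.map_mul, v.map_mul, ha, h0, zero_add, zero_add, ht, ht] at this
      exact Subtype.ext (WithTop.coe_injective this).symm
    have hun' : un x = a := by
      rw [hx, hdeg] at h1
      exact (mul_right_cancel₀ (t_ne_zero ht α) h1).symm
    simp only [f, dif_pos hpos]
    simp only [R_congr hun', hdeg]
  obtain ⟨r, hr⟩ := exists_monoidHom_eq_on (fun x : Kˣ => 0 < v (x : K))
    (fun x y hx hy => by
      rw [Units.val_mul, v.map_mul]
      exact hx.trans_le (le_add_of_nonneg_right hy.le))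
    (fun x => by
      obtain ⟨δ, hδ⟩ := WithTop.ne_top_iff_exists.mp ((v.ne_top_iff).mpr x.ne_zero)
      obtain ⟨α⟩ := hα
      -- Adding `|δ|` makes the value `δ` nonnegative, and adding `α` makes it positive.
      refine ⟨Units.mk0 _ (t_ne_zero ht ⟨|δ| + α, add_pos_of_nonneg_of_pos (abs_nonneg δ) α.2⟩),
        val_t_pos ht _, ?_⟩
      rw [Units.val_mul, Units.val_mk0, v.map_mul, ht, ← hδ, ← WithTop.coe_add, ← add_assoc]
      have : 0 ≤ δ + |δ| := neg_le_iff_add_nonneg.mp (neg_abs_le δ)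
      exact_mod_cast add_pos_of_nonneg_of_pos this α.2) f
    (fun x y hx hy => by
      obtain ⟨α, a, ha, hxa⟩ := exists_unit_mul_t ht x.ne_zero hx
      obtain ⟨β, b, hb, hyb⟩ := exists_unit_mul_t ht y.ne_zero hy
      rw [hf x α a ha hxa, hf y β b hb hyb,
        hf (x * y) (α + β) _ (val_mul (val_mul ha hb) (val_u ht α β)) ?_,
        ← map_R_mul hπ (val_mul ha hb) (val_u ht α β), ← map_R_mul hπ ha hb]
      · have h1 := (commute_map_JT_R hπ α hb).eq
        have h2 := map_JT_mul_map_JT hπ α β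
        have h3 := (commute_map_JT_R hπ (α + β) (val_u ht α β)).eq
        calc _ = π (R a ha) * π (R b hb) *
              (π (R (t α * t β / t (α + β)) (val_u ht α β)) * (π (J v) * π (T v (α + β)))) := by
              simp only [mul_assoc]
          _ = π (R a ha) * (π (R b hb) * (π (J v) * π (T v α))) * (π (J v) * π (T v β)) := by
              rw [← h3, ← h2]
              simp only [mul_assoc]
          _ = _ := by
              rw [← h1]
              simp only [mul_assoc]
      · rw [Units.val_mul, hxa, hyb]
        field_simp [t_ne_zero ht (α + β)])
  have hrt : ∀ α, r (Units.mk0 (t α) (t_ne_zero ht α)) = π (J v) * π (T v α) := by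
    intro α
    rw [hr _ (val_t_pos ht α), hf _ α 1 v.map_one (by simp), R_one, map_one, one_mul]
  refine ⟨r, fun a ha => ?_, hrt⟩
  obtain ⟨α⟩ := hα
  -- A unit is not of positive value, so `r a` is recovered from `r (a * t α)` by cancelling `r (t
  -- α)`.
  have h := hr (Units.mk0 a (ne_zero_of_val ha) * Units.mk0 (t α) (t_ne_zero ht α))
    (val_unit_mul ha (val_t_pos ht α))
  rw [hf _ α a ha (by simp), map_mul, hrt] at h
  exact mul_right_cancel h

end Torus

/-! ### Bruhat decomposition from the relations -/

/-- Elements of a group that satisfy the relations between the diagonal matrices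
`r a = diag(a, 1)`, the involution `j = -(0 1; 1 0)` and the involution `s = (-1 1; 0 1)` which give
`GL₂(K)` its Bruhat decomposition. -/
structure BruhatSystem (K G : Type*) [Field K] [Group G] where
  r : Kˣ →* G
  j : G
  s : G
  j_mul_j : j * j = 1
  s_mul_s : s * s = 1
  js_cube : (j * s) ^ 3 = 1
  commute_jr_sq : ∀ x g, Commute ((j * r x) ^ 2) g
  root_add : ∀ x y : K,
    rootMap r (s * r (-1)) (x + y) = rootMap r (s * r (-1)) x * rootMap r (s * r (-1)) y

namespace BruhatSystem

variable {K G : Type*} [Field K] [Group G] (B : BruhatSystem K G)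

/-- The root element corresponding to `(1 x; 0 1)`. -/
noncomputable def u (x : K) : G := rootMap B.r (B.s * B.r (-1)) x

theorem u_zero : B.u 0 = 1 := rootMap_zero _ _

theorem u_add (x y : K) : B.u (x + y) = B.u x * B.u y := B.root_add x y

theorem u_one : B.u 1 = B.s * B.r (-1) := rootMap_one _ _

theorem r_mul_u (c : Kˣ) (x : K) : B.r c * B.u x = B.u (c * x) * B.r c := mul_rootMap _ _ c x

theorem u_mul_r (c : Kˣ) (x : K) : B.u x * B.r c = B.r c * B.u ((c⁻¹ : Kˣ) * x) :=
  rootMap_mul _ _ c x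

theorem s_eq : B.s = B.u 1 * B.r (-1) := by
  rw [u_one, mul_assoc, ← map_mul]
  simp

theorem j_mul_r_mul_j (x : Kˣ) : B.j * B.r x * B.j = (B.j * B.r x) ^ 2 * (B.r x)⁻¹ := by
  rw [eq_mul_inv_iff_mul_eq, sq]
  simp only [mul_assoc]

/-- The central element corresponding to the scalar matrix `x`. -/
def z : Kˣ →* G :=
  MonoidHom.mk' (fun x => (B.j * B.r x) ^ 2) fun x y => by
    -- Conjugation by `j` is multiplicative and sends `r x` to `(j r x)² (r x)⁻¹`; cancelling the
    -- torus factors leaves multiplicativity of the central squares.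
    have h : B.j * B.r (x * y) * B.j = (B.j * B.r x * B.j) * (B.j * B.r y * B.j) := by
      rw [map_mul]
      calc _ = B.j * B.r x * (B.j * B.j) * (B.r y * B.j) := by
            rw [j_mul_j, mul_one]
            simp only [mul_assoc]
        _ = _ := by simp only [mul_assoc]
    rw [j_mul_r_mul_j, j_mul_r_mul_j, j_mul_r_mul_j, mul_assoc, ← mul_assoc _ ((_ * _) ^ 2),
      ← (B.commute_jr_sq y (B.r x)⁻¹).eq, mul_assoc, ← mul_inv_rev, ← map_mul, mul_comm y x,
      ← mul_assoc] at h
    exact mul_right_cancel h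

theorem commute_z (x : Kˣ) (g : G) : Commute (B.z x) g := B.commute_jr_sq x g

theorem z_apply (x : Kˣ) : B.z x = (B.j * B.r x) ^ 2 := rfl

theorem j_mul_r (x : Kˣ) : B.j * B.r x = B.z x * B.r x⁻¹ * B.j := by
  rw [map_inv, z_apply, ← j_mul_r_mul_j, mul_assoc, mul_assoc, j_mul_j, mul_one]

theorem jsj : B.j * B.s * B.j = B.s * B.j * B.s := by
  have h := B.js_cube
  have hj : B.j⁻¹ = B.j := inv_eq_of_mul_eq_one_left B.j_mul_j
  have hs : B.s⁻¹ = B.s := inv_eq_of_mul_eq_one_left B.s_mul_s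
  have : B.j * B.s * B.j = (B.s * B.j * B.s)⁻¹ := by
    rw [eq_inv_iff_mul_eq_one, ← h, pow_three]
    simp only [mul_assoc]
  rw [this, mul_inv_rev, mul_inv_rev, hj, hs, mul_assoc]

theorem mul_z_mul (g h : G) (x : Kˣ) : g * (B.z x * h) = B.z x * (g * h) := by
  rw [← mul_assoc, ← (B.commute_z x g).eq, mul_assoc]

theorem r_mul_j (x : Kˣ) : B.r x * B.j = B.z x * (B.j * B.r x⁻¹) := by
  have h := B.j_mul_r x⁻¹
  rw [inv_inv] at h
  rw [h, ← mul_assoc, ← mul_assoc, ← map_mul]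
  simp

/-- The braid relation `jsj = sjs`, rewritten through `u 1 = s r(-1)`. -/
theorem j_mul_u_one_mul_j :
    B.j * B.u 1 * B.j = B.z (-1) * (B.s * (B.j * B.u 1)) := by
  have h := B.r_mul_j (-1)
  rw [inv_neg_one] at h
  calc B.j * B.u 1 * B.j = B.j * B.s * (B.r (-1) * B.j) := by
        rw [u_one]
        simp only [mul_assoc]
    _ = B.z (-1) * (B.j * B.s * B.j * B.r (-1)) := by
        rw [h, mul_z_mul]
        simp only [mul_assoc]
    _ = _ := by
        rw [jsj, u_one]
        simp only [mul_assoc]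

/-- The conjugate by `j` of a nontrivial root element lies in the big cell. -/
theorem j_mul_u_mul_j (x : Kˣ) :
    B.j * B.u x * B.j = B.z (-1) * (B.r x⁻¹ * (B.s * (B.j * (B.u 1 * B.r x)))) := by
  have h : B.u x = B.r x * (B.u 1 * B.r x⁻¹) := by
    rw [← mul_assoc, r_mul_u, mul_assoc, ← map_mul]
    simp
  calc B.j * B.u x * B.j = (B.j * B.r x) * (B.u 1 * (B.r x⁻¹ * B.j)) := by
        rw [h]
        simp only [mul_assoc]
    _ = B.z x * (B.z x⁻¹ * (B.r x⁻¹ * ((B.j * B.u 1 * B.j) * B.r x))) := by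
        rw [j_mul_r, r_mul_j, inv_inv, mul_assoc (B.z x), mul_assoc (B.z x),
          B.mul_z_mul (B.u 1), B.mul_z_mul (B.r x⁻¹ * B.j)]
        simp only [mul_assoc]
    _ = _ := by
        rw [j_mul_u_one_mul_j, ← mul_assoc, ← map_mul, mul_inv_cancel, map_one, one_mul, mul_assoc,
          mul_z_mul]
        simp only [mul_assoc]

/-- The union of the two Bruhat cells. -/
def cells : Set G :=
  {g | ∃ c a : Kˣ, ∃ x : K, g = B.z c * B.u x * B.r a ∨
    ∃ y, g = B.z c * B.u x * B.r a * B.j * B.u y}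

theorem z_mul_mem {g : G} (c : Kˣ) (hg : g ∈ B.cells) : B.z c * g ∈ B.cells := by
  obtain ⟨c', a, x, rfl | ⟨y, rfl⟩⟩ := hg
  · exact ⟨c * c', a, x, .inl (by simp only [map_mul, mul_assoc])⟩
  · exact ⟨c * c', a, x, .inr ⟨y, by simp only [map_mul, mul_assoc]⟩⟩

theorem u_mul_mem {g : G} (x' : K) (hg : g ∈ B.cells) : B.u x' * g ∈ B.cells := by
  obtain ⟨c, a, x, rfl | ⟨y, rfl⟩⟩ := hg
  · refine ⟨c, a, x' + x, .inl ?_⟩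
    rw [u_add, ← mul_assoc, ← mul_assoc, ← (B.commute_z c _).eq, mul_assoc (B.z c)]
  · refine ⟨c, a, x' + x, .inr ⟨y, ?_⟩⟩
    simp only [u_add, ← mul_assoc]
    rw [← (B.commute_z c _).eq]

theorem r_mul_mem {g : G} (a' : Kˣ) (hg : g ∈ B.cells) : B.r a' * g ∈ B.cells := by
  obtain ⟨c, a, x, h⟩ := hg
  have e : B.r a' * (B.z c * B.u x * B.r a) = B.z c * B.u (a' * x) * B.r (a' * a) := by
    rw [← mul_assoc, ← mul_assoc, ← (B.commute_z c _).eq, mul_assoc (B.z c), r_mul_u, map_mul]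
    simp only [mul_assoc]
  obtain rfl | ⟨y, rfl⟩ := h
  · exact ⟨c, a' * a, a' * x, .inl e⟩
  · refine ⟨c, a' * a, a' * x, .inr ⟨y, ?_⟩⟩
    rw [← e]
    simp only [mul_assoc]

theorem j_mul_mem {g : G} (hg : g ∈ B.cells) : B.j * g ∈ B.cells := by
  obtain ⟨c, a, x, h⟩ := hg
  have e : B.j * (B.z c * B.u x * B.r a) = B.z c * (B.j * (B.u x * B.r a)) := by
    rw [← mul_assoc, ← mul_assoc, ← (B.commute_z c _).eq]
    simp only [mul_assoc]
  obtain rfl | ⟨y, rfl⟩ := h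
  · rw [e]
    refine B.z_mul_mem c ⟨a, a⁻¹, 0, .inr ⟨(a⁻¹ : Kˣ) * x, ?_⟩⟩
    rw [u_mul_r, ← mul_assoc, j_mul_r, u_zero, mul_one]
  · have e' : B.j * (B.z c * B.u x * B.r a * B.j * B.u y) =
        B.z c * (B.j * B.u x * (B.r a * B.j) * B.u y) := by
      have := congrArg (· * (B.j * B.u y)) e
      simpa only [mul_assoc] using this
    rw [e']
    refine B.z_mul_mem c ?_
    by_cases hx : x = 0
    · subst hx
      have : B.j * B.u 0 * (B.r a * B.j) * B.u y = B.z a * (B.r a⁻¹ * B.u y) := by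
        rw [u_zero, mul_one, r_mul_j, mul_z_mul, ← mul_assoc B.j, j_mul_j, one_mul, mul_assoc]
      rw [this]
      exact B.z_mul_mem _ (B.r_mul_mem _ ⟨1, 1, y, .inl (by simp)⟩)
    -- For `x ≠ 0` the conjugate `j u(x) j` lies in the big cell. Its torus factor `r x'` merges
    -- with `r a⁻¹` and moves left past `u 1` and `j`, leaving a single `j`.
    · have h := B.j_mul_u_mul_j (Units.mk0 x hx)
      rw [Units.val_mk0] at h
      set x' := Units.mk0 x hx
      have : B.j * B.u x * (B.r a * B.j) * B.u y =
          B.z a * (B.z (-1) * (B.r x'⁻¹ * (B.u 1 * (B.r (-1) * (B.z (x' * a⁻¹) *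
            (B.r (x' * a⁻¹)⁻¹ * (B.j * B.u (((x' * a⁻¹)⁻¹ : Kˣ) * 1 + y)))))))) := by
        calc _ = B.z a * (B.j * B.u x * B.j * (B.r a⁻¹ * B.u y)) := by
              rw [r_mul_j, mul_z_mul]
              simp only [mul_assoc]
          _ = B.z a * (B.z (-1) * (B.r x'⁻¹ * (B.s * (B.j * (B.u 1 * B.r (x' * a⁻¹) * B.u y))))) := by
              rw [h, map_mul]
              simp only [mul_assoc]
          _ = B.z a * (B.z (-1) * (B.r x'⁻¹ * (B.s * (B.j * B.r (x' * a⁻¹) *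
                (B.u (((x' * a⁻¹)⁻¹ : Kˣ) * 1) * B.u y))))) := by
              rw [u_mul_r]
              simp only [mul_assoc]
          _ = _ := by
              rw [j_mul_r, ← u_add, s_eq]
              simp only [mul_assoc]
      rw [this]
      refine B.z_mul_mem _ (B.z_mul_mem _ (B.r_mul_mem _ (B.u_mul_mem _ (B.r_mul_mem _
        (B.z_mul_mem _ (B.r_mul_mem _ ⟨1, 1, 0, .inr
          ⟨((x' * a⁻¹)⁻¹ : Kˣ) * 1 + y, ?_⟩⟩))))))
      rw [u_zero, map_one, map_one, one_mul, one_mul, one_mul]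

/-- The cells contain `1` and are stable under left multiplication by the generators; inverses add
nothing since `j` and `s` are involutions. -/
theorem mem_cells_of_closure (h : Subgroup.closure ({B.j, B.s} ∪ Set.range B.r) = ⊤) (g : G) :
    g ∈ B.cells := by
  have hs : ∀ g, g ∈ B.cells → B.s * g ∈ B.cells := by
    intro g hg
    rw [s_eq, mul_assoc]
    exact B.u_mul_mem _ (B.r_mul_mem _ hg)
  induction h ▸ Subgroup.mem_top g using Subgroup.closure_induction_left with
  | one => exact ⟨1, 1, 0, .inl (by simp [u_zero])⟩
  | mul_left x hx y _ hy =>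
    obtain (rfl | rfl) | ⟨a, rfl⟩ := hx
    exacts [B.j_mul_mem hy, hs _ hy, B.r_mul_mem _ hy]
  | inv_mul_cancel x hx y _ hy =>
    obtain (rfl | rfl) | ⟨a, rfl⟩ := hx
    · rw [inv_eq_of_mul_eq_one_left B.j_mul_j]
      exact B.j_mul_mem hy
    · rw [inv_eq_of_mul_eq_one_left B.s_mul_s]
      exact hs _ hy
    · rw [← map_inv]
      exact B.r_mul_mem _ hy

end BruhatSystem

/-! ### The relations yield a Bruhat system -/

section System

variable {K Λ : Type*} [Field K] [AddCommGroup Λ] [LinearOrder Λ] [IsOrderedAddMonoid Λ]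
  {v : AddValuation K (WithTop Λ)} {t : {α : Λ // 0 < α} → K}
  {ht : ∀ α, v (t α) = ((α : Λ) : WithTop Λ)} {𝔨 : Set K}
  {h𝔨 : IsResidueSystem v 𝔨} {G : Type*} [Group G] {π : FreeGroup (Gen v) →* G}

/-- An element of nonzero value is, up to inversion, a unit of the valuation ring times some `t α`.
-/
theorem units_induction (ht : ∀ α, v (t α) = ((α : Λ) : WithTop Λ)) {P : Kˣ → Prop}
    (hunit : ∀ (a : K) (ha : v a = 0), P (Units.mk0 a (ne_zero_of_val ha)))
    (hpow : ∀ α, P (Units.mk0 (t α) (t_ne_zero ht α)))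
    (hmul : ∀ x y, P x → P y → P (x * y)) (hinv : ∀ x, P x → P x⁻¹) (x : Kˣ) : P x := by
  have hpos : ∀ x : Kˣ, 0 < v (x : K) → P x := by
    intro x hx
    obtain ⟨α, a, ha, hxa⟩ := exists_unit_mul_t ht x.ne_zero hx
    have : x = Units.mk0 a (ne_zero_of_val ha) * Units.mk0 (t α) (t_ne_zero ht α) :=
      Units.ext (by simpa using hxa)
    rw [this]
    exact hmul _ _ (hunit a ha) (hpow α)
  rcases lt_trichotomy (v (x : K)) 0 with hx | hx | hx
  · rw [← inv_inv x]
    refine hinv _ (hpos _ ?_)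
    by_contra hle
    have h := v.map_mul ((x⁻¹ : Kˣ) : K) x
    rw [Units.inv_mul, v.map_one] at h
    exact absurd (h.trans_le (add_le_of_nonpos_left (not_lt.mp hle))) hx.not_ge
  · have := hunit x hx
    rwa [Units.mk0_val] at this
  · exact hpos x hx

theorem commute_map_of_gen {g : G} (hR : ∀ (a : K) (ha : v a = 0), Commute g (π (R a ha)))
    (hS : Commute g (π (S v))) (hJ : Commute g (π (J v))) (hT : ∀ α, Commute g (π (T v α)))
    (w : FreeGroup (Gen v)) : Commute g (π w) := by
  induction w using FreeGroup.induction_on with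
  | C1 => simp
  | of x =>
    cases x with
    | R a ha ha1 => simpa [R, ha1] using hR a ha
    | S => exact hS
    | J => exact hJ
    | T α => exact hT α
  | inv_of x h => rw [map_inv]; exact h.inv_right
  | mul x y hx hy => rw [map_mul]; exact hx.mul_right hy

theorem commute_map_Z (hπ : ∀ x y, Relation ht h𝔨 x y → π x = π y) {a : K} (ha : v a = 0)
    (w : FreeGroup (Gen v)) : Commute (π (Z a ha)) (π w) :=
  commute_map_of_gen (fun _ hb => (commute_map_R_Z hπ hb ha).symm) (commute_map_S_Z hπ ha).symm
    (commute_map_J_Z hπ ha).symm (fun α => (commute_map_T_Z hπ α ha).symm) w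

/-- By relation 7, conjugation by `T_γ` acts with order two on each `R(a)` and swaps `S` with `J_γ`,
so its square fixes these. -/
theorem commute_map_Zt (hπ : ∀ x y, Relation ht h𝔨 x y → π x = π y) (γ : {α : Λ // 0 < α})
    (w : FreeGroup (Gen v)) : Commute (π (Zt γ)) (π w) := by
  have hT : ∀ α, Commute (π (Zt γ)) (π (T v α)) := by
    intro α
    have := hπ _ _ (.T_comm_Zt α γ)
    rw [map_commutatorElement, map_one, commutatorElement_eq_one_iff_commute] at this
    exact this.symm
  have hconj : ∀ w w' : G, (π (T v γ))⁻¹ * w * π (T v γ) = w' → (π (T v γ))⁻¹ * w' * π (T v γ) = w →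
      Commute (π (Zt γ)) w := by
    intro w w' h h'
    rw [mul_assoc, inv_mul_eq_iff_eq_mul] at h h'
    rw [Zt, map_pow, Commute, SemiconjBy, sq, mul_assoc, ← h', ← mul_assoc, ← h, mul_assoc]
  have hR : ∀ (a : K) (ha : v a = 0), Commute (π (Zt γ)) (π (R a ha)) := by
    intro a ha
    refine hconj _ _ (R_conj_T hπ γ ha) ?_
    have h1 := R_conj_T hπ γ ha
    calc _ = ((π (T v γ))⁻¹ * π (R a ha) * π (T v γ))⁻¹ *
          ((π (T v γ))⁻¹ * (π (Z a ha) * π (T v γ))) := by group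
      _ = π (R a ha) := by
        rw [h1, (commute_map_Z hπ ha _).eq, inv_mul_cancel_left, mul_inv_rev, inv_inv,
          mul_assoc, (commute_map_R_Z hπ ha ha).eq, inv_mul_cancel_left]
  refine commute_map_of_gen hR ?_ ?_ hT w
  · refine hconj _ (π (Jα ht γ)) ?_ ?_
    · simpa using hπ _ _ (.S_conj_T γ)
    · simpa using hπ _ _ (.Jα_conj_T γ)
  -- Relation 8 expresses `J` through `T_γ`, `T_{γ+γ}` and some `R`, which are already known to
  -- commute with `T_γ²`.
  · have h := hπ _ _ (.T_J_T γ γ)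
    simp only [map_mul] at h
    rw [mul_assoc, ← eq_inv_mul_iff_mul_eq, ← eq_mul_inv_iff_mul_eq] at h
    rw [h]
    exact ((hT γ).inv_right.mul_right ((hT _).mul_right (hR _ _))).mul_right (hT γ).inv_right

/-- Centrality spreads from generators of `Kˣ` to products and inverses, because the squares are
multiplicative where they are central. At `t_α` the square is `T_α²`, since `J · J T_α = T_α`. -/
theorem commute_jr_sq (hπ : ∀ x y, Relation ht h𝔨 x y → π x = π y) {r : Kˣ →* G}
    (hr : ∀ (a : K) (ha : v a = 0), r (Units.mk0 a (ne_zero_of_val ha)) = π (R a ha))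
    (hrt : ∀ α, r (Units.mk0 (t α) (t_ne_zero ht α)) = π (J v) * π (T v α))
    (hsurj : Function.Surjective π) (x : Kˣ) (g : G) : Commute ((π (J v) * r x) ^ 2) g := by
  have hj := map_J_mul_map_J hπ
  have hsq : ∀ x, (π (J v) * r x) ^ 2 * (r x)⁻¹ = π (J v) * r x * π (J v) := by
    intro x
    rw [mul_inv_eq_iff_eq_mul, sq]
    simp only [mul_assoc]
  suffices h : ∀ g, Commute ((π (J v) * r x) ^ 2) g from h g
  induction x using units_induction ht with
  | hunit a ha =>
    intro g
    obtain ⟨w, rfl⟩ := hsurj g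
    rw [hr, ← map_Z hπ]
    exact commute_map_Z hπ ha w
  | hpow α =>
    intro g
    obtain ⟨w, rfl⟩ := hsurj g
    rw [hrt, ← mul_assoc, hj, one_mul, ← map_pow]
    exact commute_map_Zt hπ α w
  | hmul x y hx hy =>
    intro g
    have : (π (J v) * r (x * y)) ^ 2 = (π (J v) * r x) ^ 2 * (π (J v) * r y) ^ 2 := by
      have e : π (J v) * r (x * y) * π (J v) =
          (π (J v) * r x * π (J v)) * (π (J v) * r y * π (J v)) := by
        calc _ = π (J v) * r x * (π (J v) * π (J v)) * (r y * π (J v)) := by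
              rw [hj, mul_one, map_mul]
              simp only [mul_assoc]
          _ = _ := by simp only [mul_assoc]
      rw [← hsq, ← hsq, ← hsq, mul_assoc, ← mul_assoc _ ((_ * _) ^ 2), ← (hy (r x)⁻¹).eq, mul_assoc,
        ← mul_inv_rev, ← map_mul, mul_comm y x, ← mul_assoc] at e
      exact mul_right_cancel e
    rw [this]
    exact (hx g).mul_left (hy g)
  | hinv x hx =>
    intro g
    have : (π (J v) * r x⁻¹) ^ 2 = ((π (J v) * r x) ^ 2)⁻¹ := by
      have e : π (J v) * r x⁻¹ * π (J v) = (π (J v) * r x * π (J v))⁻¹ := by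
        rw [map_inv, mul_inv_rev, mul_inv_rev, map_J_inv hπ, mul_assoc]
      rw [← hsq, ← hsq, mul_inv_rev, ← (hx (r x)⁻¹⁻¹).inv_left.eq] at e
      simp only [map_inv] at e ⊢
      exact mul_right_cancel e
    rw [this]
    exact (hx g).inv_left

/-- This turns relations about `[S, R(a)]` into additivity of root elements; the two inner factors
`r (-1)` cancel. -/
theorem rootMap_one_mul_rootMap_neg {s : G} {r : Kˣ →* G} (a : Kˣ) (hs : s * s = 1) :
    rootMap r (s * r (-1)) 1 * rootMap r (s * r (-1)) (-a) = ⁅s, r a⁆ := by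
  have hs' : s⁻¹ = s := inv_eq_of_mul_eq_one_left hs
  have h1 : r (-1) * r (-1) = 1 := by
    rw [← map_mul]
    simp
  rw [← Units.val_neg, rootMap_unit, rootMap_one, commutatorElement_def, hs', ← neg_one_mul a,
    map_mul, mul_inv_rev]
  calc _ = s * (r (-1) * r (-1)) * r a * s * (r (-1) * ((r a)⁻¹ * (r (-1))⁻¹)) := by
        simp only [mul_assoc]
    _ = _ := by
        rw [h1, mul_one, ← map_inv, ← map_inv, ← map_mul, ← map_mul]
        congr 2
        rw [mul_left_comm, mul_inv_cancel, mul_one]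

theorem exists_bruhatSystem (hπ : ∀ x y, Relation ht h𝔨 x y → π x = π y)
    (hsurj : Function.Surjective π) (hα : Nonempty {α : Λ // 0 < α}) :
    ∃ B : BruhatSystem K G, B.j = π (J v) ∧ B.s = π (S v) ∧
      (∀ (a : K) (ha : v a = 0), B.r (Units.mk0 a (ne_zero_of_val ha)) = π (R a ha)) ∧
      ∀ α, B.r (Units.mk0 (t α) (t_ne_zero ht α)) = π (J v) * π (T v α) := by
  obtain ⟨r, hr, hrt⟩ := exists_torus hπ hα
  have hs := map_S_mul_map_S hπ
  have hm : r (-1) = π (R (-1) val_neg_one) := by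
    rw [← hr]
    congr 1
    ext
    simp
  have h1 : r (-1) * r (-1) = 1 := by
    rw [← map_mul]
    simp
  refine ⟨⟨r, π (J v), π (S v), map_J_mul_map_J hπ, hs, ?_, commute_jr_sq hπ hr hrt hsurj,
    rootMap_add v h𝔨 ?_ ?_⟩, rfl, rfl, hr, hrt⟩
  · simpa using hπ _ _ .JS_cube
  · intro a ha
    -- Relation 4 is additivity at the residue representatives.
    have h := hπ _ _ (.S_R_S a ha)
    obtain ⟨ha0, ha1⟩ := h𝔨.1 a ha
    have e1 := rootMap_one_mul_rootMap_neg (r := r) (Units.mk0 a (ne_zero_of_val ha0)) hs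
    have e2 := rootMap_unit r (π (S v) * r (-1)) (Units.mk0 (1 - a) (ne_zero_of_val ha1))
    rw [Units.val_mk0] at e1 e2
    rw [e1, e2, commutatorElement_def, map_S_inv hπ, hr _ ha0]
    simp only [map_mul] at h
    rw [h, ← hr, ← hr, ← hr, ← mul_assoc _ _ (r (-1)), mul_assoc _ (r _), mul_assoc _ (r (-1)), ← map_inv,
      ← map_inv, ← map_mul, ← map_mul]
    congr 2
    ext
    have := ne_zero_of_val ha0
    have := ne_zero_of_val ha1
    have : a - 1 ≠ 0 := by
      rwa [← neg_ne_zero, neg_sub]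
    simp
    field_simp
    ring
  · intro a ha
    have hv : v a = 0 := by
      simpa using val_one_sub ha
    have e1 := rootMap_one_mul_rootMap_neg (r := r) (Units.mk0 a (ne_zero_of_val hv)) hs
    rw [Units.val_mk0] at e1
    rw [e1, hr _ hv]
    by_cases ha1 : a = 1
    · subst ha1
      simp [R_one]
    obtain ⟨α, b, hb, hab⟩ := exists_unit_mul_t ht (sub_ne_zero.mpr (Ne.symm ha1)) ha
    -- Conjugating `J_α` to `S` by `T_α` says that `r (t α)` conjugates `S` to `S_α r(t α) S`-free
    -- form: `r (t α) S = S_α r (t α)`. This is additivity at `1 - t_α`; relation 3 then carries it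
    -- to `1 - b t_α`.
    have ht' : rootMap r (π (S v) * r (-1)) (t α) =
        ⁅π (S v), π (R (1 - t α) (val_one_sub (val_t_pos ht α)))⁆ := by
      have e2 := rootMap_unit r (π (S v) * r (-1)) (Units.mk0 (t α) (t_ne_zero ht α))
      have h := hπ _ _ (.Jα_conj_T α)
      rw [Units.val_mk0] at e2
      simp only [Jα, Sα, map_mul, map_inv, map_commutatorElement, ← hm] at h
      have h' : π (J v) * π (T v α) * π (S v) =
          ⁅π (S v), π (R (1 - t α) (val_one_sub (val_t_pos ht α)))⁆ * r (-1) *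
            (π (J v) * π (T v α)) := by
        rw [mul_assoc, inv_mul_eq_iff_eq_mul] at h
        rw [mul_assoc, ← h]
        simp only [← mul_assoc]
        rw [map_J_mul_map_J hπ, one_mul]
      rw [← hrt] at h'
      rw [e2, ← mul_assoc, h', mul_assoc _ _ (r (-1)), ← map_mul, mul_comm, map_mul, mul_assoc,
        mul_assoc, mul_assoc, mul_inv_cancel, mul_one, h1, mul_one]
    have e3 : ⁅π (S v), π (R a hv)⁆ = π (R b hb) *
        ⁅π (S v), π (R (1 - t α) (val_one_sub (val_t_pos ht α)))⁆ * (π (R b hb))⁻¹ := by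
      rw [R_congr (show a = 1 - b * t α by rw [← hab]; ring)]
      by_cases hb1 : b = 1
      · subst hb1
        rw [R_one, R_congr (show 1 - 1 * t α = 1 - t α by ring)]
        simp
      · simpa using hπ _ _ (.S_comm_R α b hb hb1)
    rw [e3, hab, ← ht', ← hr _ hb, conj_rootMap, Units.val_mk0]

end System

/-! ### The matrices satisfy the relations -/

section Matrices

variable {K Λ : Type*} [Field K] [AddCommGroup Λ] [LinearOrder Λ] [IsOrderedAddMonoid Λ]
  {v : AddValuation K (WithTop Λ)} {t : {α : Λ // 0 < α} → K}

theorem det_toMatrix_ne_zero (ht : ∀ α, v (t α) = ((α : Λ) : WithTop Λ)) (g : Gen v) :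
    (g.toMatrix t).det ≠ 0 := by
  cases g with
  | R a ha ha1 => simpa [Gen.toMatrix] using ne_zero_of_val ha
  | S => simp [Gen.toMatrix]
  | J => simp [Gen.toMatrix]
  | T α => simpa [Gen.toMatrix] using t_ne_zero ht α

/-- The matrices named by the generators, as elements of the general linear group. -/
noncomputable def genGL (ht : ∀ α, v (t α) = ((α : Λ) : WithTop Λ)) (g : Gen v) : GL (Fin 2) K :=
  Matrix.GeneralLinearGroup.mkOfDetNeZero (g.toMatrix t) (det_toMatrix_ne_zero ht g)

/-- The matrix of a word in the generators. -/
noncomputable def evalGL (ht : ∀ α, v (t α) = ((α : Λ) : WithTop Λ)) :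
    FreeGroup (Gen v) →* GL (Fin 2) K :=
  FreeGroup.lift (genGL ht)

variable (ht : ∀ α, v (t α) = ((α : Λ) : WithTop Λ))

theorem evalGL_of (g : Gen v) :
    (evalGL ht (FreeGroup.of g) : Matrix (Fin 2) (Fin 2) K) = g.toMatrix t := by
  simp [evalGL, genGL, Matrix.GeneralLinearGroup.mkOfDetNeZero]

theorem evalGL_R {a : K} (ha : v a = 0) :
    (evalGL ht (R a ha) : Matrix (Fin 2) (Fin 2) K) = !![a, 0; 0, 1] := by
  by_cases ha1 : a = 1
  · subst ha1
    simp [R_one, Matrix.one_fin_two]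
  · simp [R, ha1, evalGL_of, Gen.toMatrix]

theorem evalGL_S : (evalGL ht (S v) : Matrix (Fin 2) (Fin 2) K) = !![-1, 1; 0, 1] :=
  evalGL_of ht _

theorem evalGL_J : (evalGL ht (J v) : Matrix (Fin 2) (Fin 2) K) = !![0, -1; -1, 0] :=
  evalGL_of ht _

theorem evalGL_T (α : {α : Λ // 0 < α}) :
    (evalGL ht (T v α) : Matrix (Fin 2) (Fin 2) K) = !![0, -1; -(t α), 0] :=
  evalGL_of ht _

theorem evalGL_R_inv {a : K} (ha : v a = 0) :
    (((evalGL ht (R a ha))⁻¹ : GL (Fin 2) K) : Matrix (Fin 2) (Fin 2) K) = !![a⁻¹, 0; 0, 1] := by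
  refine Units.inv_eq_of_mul_eq_one_right ?_
  simp [evalGL_R, ne_zero_of_val ha, Matrix.one_fin_two]

theorem evalGL_S_inv :
    (((evalGL ht (S v))⁻¹ : GL (Fin 2) K) : Matrix (Fin 2) (Fin 2) K) = !![-1, 1; 0, 1] := by
  refine Units.inv_eq_of_mul_eq_one_right ?_
  simp [evalGL_S, Matrix.one_fin_two]

theorem evalGL_T_inv (α : {α : Λ // 0 < α}) :
    (((evalGL ht (T v α))⁻¹ : GL (Fin 2) K) : Matrix (Fin 2) (Fin 2) K) =
      !![0, -(t α)⁻¹; -1, 0] := by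
  refine Units.inv_eq_of_mul_eq_one_right ?_
  simp [evalGL_T, t_ne_zero ht, Matrix.one_fin_two]

theorem evalGL_Z {a : K} (ha : v a = 0) :
    (evalGL ht (Z a ha) : Matrix (Fin 2) (Fin 2) K) = !![a, 0; 0, a] := by
  by_cases ha1 : a = 1
  · subst ha1
    simp [Z_one, Matrix.one_fin_two]
  · simp [Z, ha1, evalGL_J, evalGL_R, sq]

theorem evalGL_Zt (α : {α : Λ // 0 < α}) :
    (evalGL ht (Zt α) : Matrix (Fin 2) (Fin 2) K) = !![t α, 0; 0, t α] := by
  simp [Zt, evalGL_T, sq]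

theorem evalGL_commutator_S_R {a : K} (ha : v a = 0) :
    ((⁅evalGL ht (S v), evalGL ht (R a ha)⁆ : GL (Fin 2) K) : Matrix (Fin 2) (Fin 2) K) =
      !![1, 1 - a; 0, 1] := by
  have := ne_zero_of_val ha
  simp [-Matrix.coe_units_inv, commutatorElement_def, evalGL_S, evalGL_S_inv, evalGL_R, evalGL_R_inv, this]
  ring

theorem evalGL_Sα (α : {α : Λ // 0 < α}) :
    (evalGL ht (Sα ht α) : Matrix (Fin 2) (Fin 2) K) = !![-1, t α; 0, 1] := by
  simp [Sα, evalGL_commutator_S_R, evalGL_R]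

theorem evalGL_Jα (α : {α : Λ // 0 < α}) :
    (evalGL ht (Jα ht α) : Matrix (Fin 2) (Fin 2) K) = !![1, 0; t α, -1] := by
  simp [Jα, evalGL_Sα, evalGL_J]

variable {ht} {𝔨 : Set K} {h𝔨 : IsResidueSystem v 𝔨}

theorem evalGL_eq_of_relation {x y : FreeGroup (Gen v)} (h : Relation ht h𝔨 x y) :
    evalGL ht x = evalGL ht y := by
  cases h with
  | R_mul a b ha hb _ _ =>
    ext1
    simp [evalGL_R]
  | Z_mul a b ha hb _ _ =>
    ext1
    simp [evalGL_Z]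
  | R_comm_Z a b ha hb _ _ =>
    rw [map_commutatorElement, map_one, commutatorElement_eq_one_iff_mul_comm]
    ext1
    simp [evalGL_Z, evalGL_R, mul_comm]
  | S_comm_Z a ha _ =>
    rw [map_commutatorElement, map_one, commutatorElement_eq_one_iff_mul_comm]
    ext1
    simp [evalGL_Z, evalGL_S]
  | S_sq =>
    ext1
    simp [evalGL_S, sq, Matrix.one_fin_two]
  | S_comm_R α a ha _ =>
    ext1
    simp [-Matrix.coe_units_inv, evalGL_commutator_S_R, evalGL_R, evalGL_R_inv, ne_zero_of_val ha]
  | S_R_S a ha =>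
    have : a - 1 ≠ 0 := by
      rw [← neg_ne_zero, neg_sub]
      exact ne_zero_of_val (h𝔨.1 a ha).2
    ext1
    simp [evalGL_S, evalGL_R]
    constructor
    · field_simp
    · ring
  | J_sq =>
    ext1
    simp [evalGL_J, sq, Matrix.one_fin_two]
  | JS_cube =>
    ext1
    simp [evalGL_J, evalGL_S, pow_three, Matrix.one_fin_two]
  | T_comm_Z α a ha _ =>
    rw [map_commutatorElement, map_one, commutatorElement_eq_one_iff_mul_comm]
    ext1
    simp [evalGL_Z, evalGL_T, mul_comm]
  | T_comm_Zt α γ =>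
    rw [map_commutatorElement, map_one, commutatorElement_eq_one_iff_mul_comm]
    ext1
    simp [evalGL_Zt, evalGL_T, mul_comm]
  | R_conj_T α a ha _ =>
    ext1
    simp [-Matrix.coe_units_inv, evalGL_Z, evalGL_T, evalGL_T_inv, evalGL_R,
      evalGL_R_inv, t_ne_zero ht, ne_zero_of_val ha]
  | S_conj_T α =>
    ext1
    simp [-Matrix.coe_units_inv, evalGL_Jα, evalGL_T, evalGL_T_inv, evalGL_S, t_ne_zero ht]
  | Jα_conj_T α =>
    ext1
    simp [-Matrix.coe_units_inv, evalGL_Jα, evalGL_T, evalGL_T_inv, evalGL_S, t_ne_zero ht]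
  | T_J_T α β =>
    have := t_ne_zero ht (α + β)
    ext1
    simp [evalGL_J, evalGL_T, evalGL_R]
    field_simp

/-- The homomorphism from the presented group to `GL₂(K)`. -/
noncomputable def presentedToGL (ht : ∀ α, v (t α) = ((α : Λ) : WithTop Λ))
    (h𝔨 : IsResidueSystem v 𝔨) : PresentedGroup (relators ht h𝔨) →* GL (Fin 2) K :=
  PresentedGroup.toGroup (f := genGL ht) (by
    rintro w ⟨x, y, hxy, rfl⟩
    change evalGL ht (x * y⁻¹) = 1
    rw [map_mul, map_inv, evalGL_eq_of_relation hxy, mul_inv_cancel])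

theorem presentedToGL_mk (w : FreeGroup (Gen v)) :
    presentedToGL ht h𝔨 (PresentedGroup.mk _ w) = evalGL ht w := rfl

theorem mk_eq_of_relation (x y : FreeGroup (Gen v)) (h : Relation ht h𝔨 x y) :
    PresentedGroup.mk (relators ht h𝔨) x = PresentedGroup.mk _ y := by
  rw [← mul_inv_eq_one, ← map_inv, ← map_mul]
  exact PresentedGroup.one_of_mem ⟨x, y, h, rfl⟩

end Matrices

/-! ### Comparing the cells with `GL₂(K)` -/

namespace BruhatSystem

variable {K G : Type*} [Field K] [Group G] (B : BruhatSystem K G) {φ : G →* GL (Fin 2) K}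

theorem coe_map_u (hr : ∀ x : Kˣ, (φ (B.r x) : Matrix (Fin 2) (Fin 2) K) = !![(x : K), 0; 0, 1])
    (hs : (φ B.s : Matrix (Fin 2) (Fin 2) K) = !![-1, 1; 0, 1]) (x : K) :
    (φ (B.u x) : Matrix (Fin 2) (Fin 2) K) = !![1, x; 0, 1] := by
  by_cases hx : x = 0
  · simp [hx, u_zero, Matrix.one_fin_two]
  · lift x to Kˣ using isUnit_iff_ne_zero.mpr hx
    rw [u, rootMap_unit, ← map_inv]
    simp [-map_inv, hr, hs]

theorem coe_map_z (hr : ∀ x : Kˣ, (φ (B.r x) : Matrix (Fin 2) (Fin 2) K) = !![(x : K), 0; 0, 1])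
    (hj : (φ B.j : Matrix (Fin 2) (Fin 2) K) = !![0, -1; -1, 0]) (x : Kˣ) :
    (φ (B.z x) : Matrix (Fin 2) (Fin 2) K) = !![(x : K), 0; 0, (x : K)] := by
  simp [z_apply, sq, hr, hj]

/-- A big-cell element has lower-left entry `-c ≠ 0`, so it cannot map to `1`; in the small cell the
matrix determines all parameters. -/
theorem injective_of_closure
    (hr : ∀ x : Kˣ, (φ (B.r x) : Matrix (Fin 2) (Fin 2) K) = !![(x : K), 0; 0, 1])
    (hs : (φ B.s : Matrix (Fin 2) (Fin 2) K) = !![-1, 1; 0, 1])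
    (hj : (φ B.j : Matrix (Fin 2) (Fin 2) K) = !![0, -1; -1, 0])
    (h : Subgroup.closure ({B.j, B.s} ∪ Set.range B.r) = ⊤) : Function.Injective φ := by
  rw [injective_iff_map_eq_one]
  intro g hg
  have hg' := congrArg (fun M : GL (Fin 2) K => (M : Matrix (Fin 2) (Fin 2) K)) hg
  obtain ⟨c, a, x, rfl | ⟨y, rfl⟩⟩ := B.mem_cells_of_closure h g
  · simp [B.coe_map_u hr hs, B.coe_map_z hr hj, hr, Matrix.one_fin_two] at hg'
    obtain ⟨⟨h1, h2⟩, rfl⟩ := hg'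
    simp at h1 h2
    simp [h1, h2, u_zero]
  · simp [B.coe_map_u hr hs, B.coe_map_z hr hj, hr, hj, Matrix.one_fin_two] at hg'

theorem map_surjective
    (hr : ∀ x : Kˣ, (φ (B.r x) : Matrix (Fin 2) (Fin 2) K) = !![(x : K), 0; 0, 1])
    (hs : (φ B.s : Matrix (Fin 2) (Fin 2) K) = !![-1, 1; 0, 1])
    (hj : (φ B.j : Matrix (Fin 2) (Fin 2) K) = !![0, -1; -1, 0]) : Function.Surjective φ := by
  intro M
  have hdet : (M : Matrix (Fin 2) (Fin 2) K).det ≠ 0 := M.det_ne_zero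
  have hM := Matrix.eta_fin_two (M : Matrix (Fin 2) (Fin 2) K)
  rw [Matrix.det_fin_two] at hdet
  generalize (M : Matrix (Fin 2) (Fin 2) K) 0 0 = p at hdet hM
  generalize (M : Matrix (Fin 2) (Fin 2) K) 0 1 = q at hdet hM
  generalize (M : Matrix (Fin 2) (Fin 2) K) 1 0 = c at hdet hM
  generalize (M : Matrix (Fin 2) (Fin 2) K) 1 1 = d at hdet hM
  by_cases hc : c = 0
  · subst hc
    rw [mul_zero, sub_zero] at hdet
    have hp := left_ne_zero_of_mul hdet
    have hd := right_ne_zero_of_mul hdet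
    refine ⟨B.z (Units.mk0 d hd) * B.u (q / d) * B.r (Units.mk0 (p / d) (div_ne_zero hp hd)), ?_⟩
    ext1
    rw [hM]
    simp [B.coe_map_u hr hs, B.coe_map_z hr hj, hr]
    constructor <;> field_simp
  -- The lower-left entry fixes the scalar, the first column and bottom row fix the two root
  -- elements, and the determinant fixes the torus element.
  · refine ⟨B.z (Units.mk0 (-c) (neg_ne_zero.mpr hc)) * B.u (p / c) *
      B.r (Units.mk0 (-(p * d - q * c) / c ^ 2)
        (div_ne_zero (neg_ne_zero.mpr hdet) (pow_ne_zero 2 hc))) * B.j * B.u (d / c), ?_⟩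
    ext1
    rw [hM]
    simp [B.coe_map_u hr hs, B.coe_map_z hr hj, hr, hj]
    refine ⟨⟨?_, ?_⟩, ?_⟩ <;> field_simp
    ring

end BruhatSystem

end ValuedGL2

/-! ### The isomorphism -/

open ValuedGL2 in
theorem theorem4p6 {K Λ : Type*} [Field K] [AddCommGroup Λ] [LinearOrder Λ]
    [IsOrderedAddMonoid Λ] (v : AddValuation K (WithTop Λ))
    (hvalue : ∀ α : Λ, ∃ x : K, v x = (α : WithTop Λ))
    (hnontrivial : ∃ x : K, v x < 0)
    (t : {α : Λ // 0 < α} → K) (ht : ∀ α, v (t α) = ((α : Λ) : WithTop Λ))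
    (𝔨 : Set K) (h𝔨 : ValuedGL2.IsResidueSystem v 𝔨) :
    ∃ e : PresentedGroup (ValuedGL2.relators ht h𝔨) ≃* GL (Fin 2) K,
      (∀ g : ValuedGL2.Gen v,
        ((e (PresentedGroup.of g) : GL (Fin 2) K) : Matrix (Fin 2) (Fin 2) K) = g.toMatrix t) ∧
      (∀ (a : K) (ha : v a = 0),
        ((e (PresentedGroup.mk _ (ValuedGL2.Z a ha)) : GL (Fin 2) K) :
          Matrix (Fin 2) (Fin 2) K) = !![a, 0; 0, a]) ∧
      (∀ α : {α : Λ // 0 < α},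
        ((e (PresentedGroup.mk _ (ValuedGL2.Zt α)) : GL (Fin 2) K) :
          Matrix (Fin 2) (Fin 2) K) = !![t α, 0; 0, t α]) ∧
      (∀ α : {α : Λ // 0 < α},
        ((e (PresentedGroup.mk _ (ValuedGL2.Jα ht α)) : GL (Fin 2) K) :
          Matrix (Fin 2) (Fin 2) K) = !![1, 0; t α, -1]) := by
  have hα : Nonempty {α : Λ // 0 < α} := by
    obtain ⟨x, hx⟩ := hnontrivial
    obtain ⟨δ, hδ⟩ := WithTop.ne_top_iff_exists.mp (hx.trans_le le_top).ne
    rw [← hδ] at hx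
    exact ⟨⟨-δ, neg_pos.mpr (by exact_mod_cast hx)⟩⟩
  have hsurj : Function.Surjective (PresentedGroup.mk (relators ht h𝔨)) :=
    PresentedGroup.mk_surjective _
  obtain ⟨B, hBj, hBs, hBr, hBt⟩ := exists_bruhatSystem
    (π := PresentedGroup.mk (relators ht h𝔨)) mk_eq_of_relation hsurj hα
  have hj : (presentedToGL ht h𝔨 B.j : Matrix (Fin 2) (Fin 2) K) = !![0, -1; -1, 0] := by
    rw [hBj, presentedToGL_mk, evalGL_J]
  have hs : (presentedToGL ht h𝔨 B.s : Matrix (Fin 2) (Fin 2) K) = !![-1, 1; 0, 1] := by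
    rw [hBs, presentedToGL_mk, evalGL_S]
  have hr : ∀ x : Kˣ, (presentedToGL ht h𝔨 (B.r x) : Matrix (Fin 2) (Fin 2) K) =
      !![(x : K), 0; 0, 1] := by
    intro x
    induction x using units_induction ht with
    | hunit a ha => rw [hBr a ha, presentedToGL_mk, evalGL_R, Units.val_mk0]
    | hpow α =>
      rw [hBt, ← map_mul, presentedToGL_mk]
      simp [evalGL_J, evalGL_T]
    | hmul x y hx hy => simp [hx, hy]
    | hinv x hx =>
      rw [map_inv, map_inv]
      refine Units.inv_eq_of_mul_eq_one_right ?_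
      simp [hx, Matrix.one_fin_two]
  have hclosure : Subgroup.closure ({B.j, B.s} ∪ Set.range B.r) = ⊤ := by
    rw [eq_top_iff, ← PresentedGroup.closure_range_of, Subgroup.closure_le]
    have hJ : B.j ∈ Subgroup.closure ({B.j, B.s} ∪ Set.range B.r) :=
      Subgroup.subset_closure (.inl (.inl rfl))
    rintro _ ⟨g, rfl⟩
    cases g with
    | R a ha ha1 =>
      have h := hBr a ha
      rw [R, dif_neg ha1] at h
      exact Subgroup.subset_closure (.inr ⟨_, h⟩)
    | S => exact Subgroup.subset_closure (.inl (.inr hBs.symm))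
    | J => exact hBj ▸ hJ
    | T α =>
      -- As `J` is an involution, `T_α = J r(t_α)`, so the torus together with `J` and `S`
      -- generates.
      have h : PresentedGroup.mk (relators ht h𝔨) (T v α) =
          B.j * B.r (Units.mk0 (t α) (t_ne_zero ht α)) := by
        rw [hBt, ← hBj, ← mul_assoc, B.j_mul_j, one_mul]
      change PresentedGroup.mk (relators ht h𝔨) (T v α) ∈ _
      rw [h]
      exact mul_mem hJ (Subgroup.subset_closure (.inr ⟨_, rfl⟩))
  refine ⟨MulEquiv.ofBijective (presentedToGL ht h𝔨)
    ⟨B.injective_of_closure hr hs hj hclosure, B.map_surjective hr hs hj⟩, fun g => ?_,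
    fun a ha => ?_, fun α => ?_, fun α => ?_⟩
  · exact evalGL_of ht g
  · exact evalGL_Z ht ha
  · exact evalGL_Zt ht α
  · exact evalGL_Jα ht α
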